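/- Let $K$ be a field. For $n\ge 1$ let $R_n=K[x_1,\dots,x_n]$ be the standard graded polynomial ring, $\mathfrak m_n=(x_1,\dots,x_n)$ its irrelevant maximal ideal, and for $1\le d\le n$ let $I_{n,d}\subseteq R_n$ be the squarefree Veronese ideal, generated by all squarefree monomials of degree $d$. A Hilbert decomposition of a finitely generated $\mathbb Z$-graded $R_n$-module $M$ is a finite family $(S_i,s_i)$, where each $S_i$ is a graded $K$-algebra retract of $R_n$ and $s_i\in\mathbb Z$, such that $M\cong\bigoplus_i S_i(-s_i)$ as graded $K$-vector spaces; its Hilbert depth is $\min_i \operatorname{depth} S_i(-s_i)$, and $\operatorname{Hdepth} M$ is the maximum of the Hilbert depths of all Hilbert decompositions of $M$. **Theorem 1.3.** The two statements (a) $\operatorname{Hdepth}(\mathfrak m_n^{\,s})=\left\lceil \dfrac{n}{s+1}\right\rceil$ for all integers $n\ge 1$ and $s\ge 1$, (b) $\operatorname{Hdepth}(I_{n,d})=d-1+\left\lceil \dfrac{n-(d-1)}{d+1}\right\rceil$ for all integers $n\ge d\ge 1$ are equivalent, that is, they imply each other. Moreover, the equivalence holds for each choice of parameters: for all integers $n\ge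 d\ge 1$, the formula in (b) holds for $I_{n,d}$ if and only if the formula in (a) holds for $\mathfrak m_{n-d+1}^{\,d}\subseteq R_{n-d+1}$, that is, if and only if $\operatorname{Hdepth}(\mathfrak m_{n-d+1}^{\,d})=\left\lceil \dfrac{n-d+1}{d+1}\right\rceil$. -/

import Mathlib

/-!
Hilbert decompositions and Hilbert depth over the standard graded polynomial ring
`R = K[x_1, …, x_n]`, formalised as `MvPolynomial (Fin n) K`.
-/

namespace HilbertDepth

open scoped DirectSum

/-- The homogeneous component `R_k` of the standard graded polynomial ring `R = K[x_1, …, x_n]`,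
for `k : ℤ` (every variable has degree `1`; `R_k = 0` for `k < 0`). -/
noncomputable def polyPart (K : Type*) [Field K] (n : ℕ) (k : ℤ) :
    Submodule K (MvPolynomial (Fin n) K) :=
  MvPolynomial.weightedHomogeneousSubmodule K (fun _ : Fin n => (1 : ℤ)) k

/-- The irrelevant maximal ideal `𝔪 = (x_1, …, x_n)` of `R`. -/
noncomputable def irrelevantIdeal (K : Type*) [Field K] (n : ℕ) :
    Ideal (MvPolynomial (Fin n) K) :=
  Ideal.span (Set.range MvPolynomial.X)

/-- The squarefree Veronese ideal `I_{n,d}` of `R`, generated by all squarefree monomials of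
degree `d`. -/
noncomputable def squarefreeVeronese (K : Type*) [Field K] (n d : ℕ) :
    Ideal (MvPolynomial (Fin n) K) :=
  Ideal.span {f | ∃ A : Finset (Fin n), A.card = d ∧ f = ∏ i ∈ A, MvPolynomial.X i}

/-- `S` is a graded `K`-algebra retract of `R`: there is a degree-preserving `K`-algebra
homomorphism `ρ : R → S` that is the identity on `S`. (Then `S` is automatically a graded
subalgebra: the components of `x = ρ x` are the images under `ρ` of the components of `x`.) -/
def IsGradedRetract {K : Type*} [Field K] {n : ℕ}
    (S : Subalgebra K (MvPolynomial (Fin n) K)) : Prop :=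
  ∃ ρ : MvPolynomial (Fin n) K →ₐ[K] S,
    (∀ x : S, ρ (x : MvPolynomial (Fin n) K) = x) ∧
    ∀ (k : ℤ), ∀ f ∈ polyPart K n k, ((ρ f : S) : MvPolynomial (Fin n) K) ∈ polyPart K n k

/-- The component of degree `k` of the shifted module `S(-s)`, i.e. `S(-s)_k = S_{k - s}`. -/
noncomputable def shiftPart {K : Type*} [Field K] {n : ℕ}
    (S : Subalgebra K (MvPolynomial (Fin n) K)) (s k : ℤ) : Submodule K S :=
  (polyPart K n (k - s)).comap S.val.toLinearMap

/-- The depth of an `A`-module `N` with respect to an ideal `J`: the supremum of the lengths of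
the `N`-regular sequences of elements of `J`. -/
noncomputable def depth {A : Type*} [CommRing A] (J : Ideal A) (N : Type*) [AddCommGroup N]
    [Module A N] : ℕ∞ :=
  ⨆ rs ∈ {rs : List A | (∀ r ∈ rs, r ∈ J) ∧ RingTheory.Sequence.IsRegular N rs},
    (rs.length : ℕ∞)

/-- The depth of a graded retract `S` of `R`, as a module over itself with respect to its
irrelevant ideal `𝔪 ∩ S`. A shift of the grading does not change it, so this is also the
depth of `S(-s)`. -/
noncomputable def retractDepth {K : Type*} [Field K] {n : ℕ}
    (S : Subalgebra K (MvPolynomial (Fin n) K)) : ℕ∞ :=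
  depth ((irrelevantIdeal K n).comap S.val.toRingHom) S

/-- A Hilbert decomposition over `R = K[x_1, …, x_n]` (in the standard graded case) of a graded
module `M = ⨁ₖ 𝓜 k`: a finite family `(S_i, s_i)` of graded `K`-algebra retracts `S_i` of `R` and
integers `s_i` such that `M ≅ ⨁ᵢ S_i(-s_i)` as graded `K`-vector spaces. Only the underlying graded
`K`-vector space of `M` enters. -/
structure HilbertDecomposition {K : Type*} [Field K] (n : ℕ) {M : Type*} [AddCommGroup M]
    [Module K M] (𝓜 : ℤ → Submodule K M) where
  /-- the number of summands -/
  size : ℕ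
  /-- the retracts `S_i` -/
  S : Fin size → Subalgebra K (MvPolynomial (Fin n) K)
  /-- the shifts `s_i` -/
  s : Fin size → ℤ
  isGradedRetract : ∀ i, IsGradedRetract (S i)
  exists_gradedIso : ∃ e : M ≃ₗ[K] (⨁ i : Fin size, S i),
    ∀ (k : ℤ) (x : M), x ∈ 𝓜 k ↔ ∀ i, e x i ∈ shiftPart (S i) (s i) k

/-- The Hilbert depth `minᵢ depth S_i(-s_i)` of a Hilbert decomposition. -/
noncomputable def HilbertDecomposition.hdepth {K : Type*} [Field K] {n : ℕ} {M : Type*}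
    [AddCommGroup M] [Module K M] {𝓜 : ℤ → Submodule K M} (H : HilbertDecomposition n 𝓜) : ℕ∞ :=
  ⨅ i, retractDepth (H.S i)

/-- The Hilbert depth of a graded module: the maximum of the Hilbert depths of its Hilbert
decompositions. It is formed as a supremum in `ℕ∞`; a supremum that equals a positive natural
number is attained. -/
noncomputable def gradedHdepth {K : Type*} [Field K] (n : ℕ) {M : Type*}
    [AddCommGroup M] [Module K M] (𝓜 : ℤ → Submodule K M) : ℕ∞ :=
  ⨆ H : HilbertDecomposition n 𝓜, H.hdepth

/-- The component of degree `k` of a homogeneous ideal `I` of `R`, regarded as a graded module. -/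
noncomputable def idealPart {K : Type*} [Field K] {n : ℕ} (I : Ideal (MvPolynomial (Fin n) K))
    (k : ℤ) : Submodule K I :=
  (polyPart K n k).comap (I.subtype.restrictScalars K)

/-- The Hilbert depth of a homogeneous ideal of `R = K[x_1, …, x_n]`. -/
noncomputable def Hdepth {K : Type*} [Field K] {n : ℕ} (I : Ideal (MvPolynomial (Fin n) K)) : ℕ∞ :=
  gradedHdepth n (idealPart I)

/-- The formula `Hdepth (𝔪 ^ s) = ⌈n / (s + 1)⌉` for `𝔪 ⊂ K[x_1, …, x_n]`. -/
def PowerFormula (K : Type*) [Field K] (n s : ℕ) : Prop :=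
  Hdepth (irrelevantIdeal K n ^ s) = (⌈(n : ℚ) / ((s : ℚ) + 1)⌉₊ : ℕ∞)

/-- The formula `Hdepth I_{n,d} = d - 1 + ⌈(n - (d - 1)) / (d + 1)⌉` (used for `1 ≤ d ≤ n`, where
the subtractions are the usual ones). -/
def VeroneseFormula (K : Type*) [Field K] (n d : ℕ) : Prop :=
  Hdepth (squarefreeVeronese K n d) =
    ((d - 1 + ⌈((n : ℚ) - ((d : ℚ) - 1)) / ((d : ℚ) + 1)⌉₊ : ℕ) : ℕ∞)

end HilbertDepth

/-! Hilbert depth depends only on the Hilbert function. A graded retract is a polynomial ring in `r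
≤ n` linear forms and has depth `r`, so a decomposition of depth at least `p` exists exactly when
the Hilbert function is a finite sum of shifted `polyHilb r_i` with `p ≤ r_i ≤ n`
(`exists_le_hdepth_iff`).

Put `e = d - 1` and `m = n - e`. Multiplying the Hilbert series of `I_{n,d}` by `(1 - t)^e` gives
that of `𝔪^d` in `m` variables (`diff_pow_veroneseHilb`), and the same factor turns the series of a
polynomial ring in `r + e` variables into that of one in `r` variables. The factor is injective on
series bounded below, so numerical decompositions correspond under `r ↔ r + e`
(`powerHilb_eq_sum_iff`), and the bounds `r ≤ m` and `r + e ≤ n` match. Positive depth thresholds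
therefore shift by exactly `d - 1`, as do the two formulas. -/

namespace HilbertDepth

/-! ### Counting monomials by degree. -/

/-- The number of exponent vectors of total degree `k` in `n` variables satisfying `P`. -/
noncomputable def monomialCount (n : ℕ) (P : (Fin n →₀ ℕ) → Prop) (k : ℤ) : ℕ :=
  Nat.card {a : Fin n →₀ ℕ // P a ∧ (a.degree : ℤ) = k}

lemma finite_degree_eq (n : ℕ) (P : (Fin n →₀ ℕ) → Prop) (k : ℤ) :
    Finite {a : Fin n →₀ ℕ // P a ∧ (a.degree : ℤ) = k} := by
  refine Set.Finite.to_subtype (s := {a | P a ∧ (a.degree : ℤ) = k}) ?_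
  refine (Finsupp.finite_of_degree_le (σ := Fin n) k.toNat).subset ?_
  rintro a ⟨-, ha⟩
  simp only [Set.mem_ofPred_eq]
  omega

lemma degree_cons {n : ℕ} (i : ℕ) (b : Fin n →₀ ℕ) : (Finsupp.cons i b).degree = i + b.degree := by
  simp [Finsupp.degree_eq_sum, Fin.sum_univ_succ]

lemma card_support_cons_zero {n : ℕ} (b : Fin n →₀ ℕ) :
    (Finsupp.cons 0 b).support.card = b.support.card := by
  have : (Finsupp.cons 0 b).support = b.support.map (Fin.succEmb n) := by
    ext i
    refine Fin.cases ?_ (fun j => ?_) i <;> simp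
  rw [this, Finset.card_map]

lemma card_support_add_single_zero {n : ℕ} (a : Fin (n + 1) →₀ ℕ) :
    (a + Finsupp.single 0 1).support.card = (Finsupp.tail a).support.card + 1 := by
  have : (a + Finsupp.single 0 1).support
      = insert 0 ((Finsupp.tail a).support.map (Fin.succEmb n)) := by
    ext i
    refine Fin.cases ?_ (fun j => ?_) i <;> simp [Fin.succ_ne_zero, Finsupp.tail_apply]
  rw [this, Finset.card_insert_of_notMem (by simp [Fin.succ_ne_zero]), Finset.card_map]

/-- Splitting off the monomials that are divisible by the first variable. -/
lemma monomialCount_succ (n : ℕ) (P : (Fin (n + 1) →₀ ℕ) → Prop) (k : ℤ) :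
    monomialCount (n + 1) P k = monomialCount n (fun b => P (Finsupp.cons 0 b)) k +
      monomialCount (n + 1) (fun a => P (a + Finsupp.single 0 1)) (k - 1) := by
  classical
  have := finite_degree_eq (n + 1) P k
  have := finite_degree_eq n (fun b => P (Finsupp.cons 0 b)) k
  have := finite_degree_eq (n + 1) (fun a => P (a + Finsupp.single 0 1)) (k - 1)
  unfold monomialCount
  rw [← Nat.card_sum]
  refine Nat.card_congr (Equiv.symm (Equiv.ofBijective (Sum.elim
    (fun b => ⟨Finsupp.cons 0 b.1, b.2.1, by simpa [degree_cons] using b.2.2⟩)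
    (fun a => ⟨a.1 + Finsupp.single 0 1, a.2.1, by
      have := a.2.2
      simp only [map_add, Finsupp.degree_single]; push_cast; omega⟩)) ⟨?_, ?_⟩))
  · rintro (⟨b, hb⟩ | ⟨a, ha⟩) (⟨b', hb'⟩ | ⟨a', ha'⟩) h
    · simp only [Sum.elim_inl, Subtype.mk.injEq] at h
      simpa using Finsupp.cons_right_injective 0 h
    · have := DFunLike.congr_fun (congrArg Subtype.val h) 0
      simp at this
    · have := DFunLike.congr_fun (congrArg Subtype.val h) 0
      simp at this
    · simpa using h
  · rintro ⟨a, hP, ha⟩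
    rcases Nat.eq_zero_or_pos (a 0) with h0 | h0
    · have hc : Finsupp.cons 0 (Finsupp.tail a) = a := by rw [← h0, Finsupp.cons_tail]
      have hd := degree_cons 0 (Finsupp.tail a)
      rw [hc, zero_add] at hd
      exact ⟨.inl ⟨Finsupp.tail a, (congrArg P hc).mpr hP, by rw [← hd, ha]⟩, Subtype.ext hc⟩
    · have hs : Finsupp.single 0 1 ≤ a := by
        rw [Finsupp.single_le_iff]; exact h0
      have hc := tsub_add_cancel_of_le hs
      have hd := congrArg Finsupp.degree hc
      rw [map_add, Finsupp.degree_single] at hd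
      exact ⟨.inr ⟨a - Finsupp.single 0 1, (congrArg P hc).mpr hP, by omega⟩, Subtype.ext hc⟩

lemma monomialCount_congr {n : ℕ} {P Q : (Fin n →₀ ℕ) → Prop} (h : ∀ a, P a ↔ Q a) :
    monomialCount n P = monomialCount n Q := by
  rw [show P = Q from funext fun a => propext (h a)]

lemma monomialCount_of_neg {n : ℕ} (P : (Fin n →₀ ℕ) → Prop) {k : ℤ} (hk : k < 0) :
    monomialCount n P k = 0 := by
  have : IsEmpty {a : Fin n →₀ ℕ // P a ∧ (a.degree : ℤ) = k} := ⟨fun a => by have := a.2.2; omega⟩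
  exact Nat.card_of_isEmpty

lemma monomialCount_false {n : ℕ} {P : (Fin n →₀ ℕ) → Prop} (hP : ∀ a, ¬ P a) (k : ℤ) :
    monomialCount n P k = 0 := by
  have : IsEmpty {a : Fin n →₀ ℕ // P a ∧ (a.degree : ℤ) = k} := ⟨fun a => hP _ a.2.1⟩
  exact Nat.card_of_isEmpty

/-- The Hilbert function of the polynomial ring in `r` variables. -/
noncomputable def polyHilb (r : ℕ) (k : ℤ) : ℤ := monomialCount r (fun _ => True) k

/-- The Hilbert function of `𝔪 ^ d` in `n` variables. -/
noncomputable def powerHilb (n d : ℕ) (k : ℤ) : ℤ := monomialCount n (fun a => d ≤ a.degree) k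

/-- The Hilbert function of the squarefree Veronese ideal of degree `d` in `n` variables. -/
noncomputable def veroneseHilb (n d : ℕ) (k : ℤ) : ℤ :=
  monomialCount n (fun a => d ≤ a.support.card) k

/-! ### Difference operators and the numerical correspondence. -/

/-- The shift `f ↦ (k ↦ f (k - 1))`, that is, multiplication of Hilbert series by `t`. -/
def shift : Module.End ℤ (ℤ → ℤ) := LinearMap.funLeft ℤ ℤ (fun k => k - 1)

/-- The backward difference, that is, multiplication of Hilbert series by `1 - t`. -/
def diff : Module.End ℤ (ℤ → ℤ) := 1 - shift

lemma shift_apply (f : ℤ → ℤ) (k : ℤ) : shift f k = f (k - 1) := rfl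

lemma diff_apply (f : ℤ → ℤ) (k : ℤ) : diff f k = f k - f (k - 1) := rfl

lemma diff_pow_shift (e : ℕ) (f : ℤ → ℤ) : (diff ^ e) (shift f) = shift ((diff ^ e) f) := by
  have : Commute (diff ^ e) shift := ((Commute.one_left _).sub_left (Commute.refl _)).pow_left e
  exact LinearMap.congr_fun this f

lemma diff_pow_translate (e : ℕ) (f : ℤ → ℤ) (s : ℤ) :
    (diff ^ e) (fun k => f (k - s)) = fun k => (diff ^ e) f (k - s) := by
  induction e generalizing f with
  | zero => rfl
  | succ e ih =>
    have : diff (fun k => f (k - s)) = fun k => diff f (k - s) := by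
      ext k
      simp only [diff_apply]
      rw [show k - 1 - s = k - s - 1 by ring]
    rw [pow_succ, Module.End.mul_apply, Module.End.mul_apply, this, ih]

/-- A function with zero difference is constant, hence zero if it vanishes far to the left. The
bound `N` survives each difference, so it stays fixed in the induction. -/
lemma eq_zero_of_diff_pow_eq_zero (e : ℕ) (f : ℤ → ℤ) (N : ℤ) (hN : ∀ k < N, f k = 0)
    (h : (diff ^ e) f = 0) : f = 0 := by
  induction e generalizing f with
  | zero => exact h
  | succ e ih =>
    rw [pow_succ, Module.End.mul_apply] at h
    have hd := ih (diff f) (fun k hk => by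
      rw [diff_apply, hN k hk, hN (k - 1) (by omega), sub_zero]) h
    have hn : ∀ j : ℕ, f (N - 1 + j) = 0 := by
      intro j
      induction j with
      | zero => exact hN _ (by simp)
      | succ j ihj =>
        have := congrFun hd (N - 1 + (j + 1 : ℕ))
        rw [diff_apply, show N - 1 + ((j + 1 : ℕ) : ℤ) - 1 = N - 1 + j by push_cast; ring, ihj] at this
        simpa using this
    ext k
    rcases lt_or_ge k N with hk | hk
    · exact hN k hk
    · have := hn (k - (N - 1)).toNat
      rwa [Int.toNat_of_nonneg (by omega), add_sub_cancel] at this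

lemma diff_polyHilb (r : ℕ) : diff (polyHilb (r + 1)) = polyHilb r := by
  ext k
  rw [diff_apply]
  simp only [polyHilb]
  rw [monomialCount_succ]
  push_cast
  ring

lemma diff_pow_polyHilb (e r : ℕ) : (diff ^ e) (polyHilb (r + e)) = polyHilb r := by
  induction e with
  | zero => rfl
  | succ e ih => rw [pow_succ, Module.End.mul_apply, ← add_assoc, diff_polyHilb, ih]

/-- A monomial either omits the first variable or is that variable times an arbitrary monomial of
degree one less. -/
lemma powerHilb_succ (n d : ℕ) :
    powerHilb (n + 1) (d + 1) = powerHilb n (d + 1) + shift (powerHilb (n + 1) d) := by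
  ext k
  simp only [powerHilb, Pi.add_apply, shift_apply]
  rw [monomialCount_succ]
  simp [degree_cons]

/-- Once the first variable divides a monomial, its exponent no longer affects the support
condition. That free exponent contributes a factor `1/(1 - t)`, which the outer `diff` clears. -/
lemma diff_veroneseHilb_succ (n d : ℕ) :
    diff (veroneseHilb (n + 1) (d + 1)) =
      diff (veroneseHilb n (d + 1)) + shift (veroneseHilb n d) := by
  have h1 (k : ℤ) : veroneseHilb (n + 1) (d + 1) k = veroneseHilb n (d + 1) k +
      monomialCount (n + 1) (fun a => d ≤ (Finsupp.tail a).support.card) (k - 1) := by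
    simp only [veroneseHilb]
    rw [monomialCount_succ]
    simp only [card_support_cons_zero, card_support_add_single_zero, add_le_add_iff_right]
    push_cast
    rfl
  have h2 (k : ℤ) :
      (monomialCount (n + 1) (fun a => d ≤ (Finsupp.tail a).support.card) k : ℤ) =
      veroneseHilb n d k +
        monomialCount (n + 1) (fun a => d ≤ (Finsupp.tail a).support.card) (k - 1) := by
    have ht (a : Fin (n + 1) →₀ ℕ) :
        Finsupp.tail (a + Finsupp.single 0 1) = Finsupp.tail a := by
      ext i
      simp [Finsupp.tail_apply]
    rw [monomialCount_succ]
    simp only [Finsupp.tail_cons, ht]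
    push_cast
    rfl
  ext k
  simp only [Pi.add_apply, diff_apply, shift_apply]
  rw [h1 k, h1 (k - 1), h2 (k - 1)]
  ring

/-- The Hilbert series of `𝔪 ^ d` in `n - d + 1` variables is `(1 - t) ^ (d - 1)` times that of
`I_{n,d}`. -/
lemma diff_pow_veroneseHilb (m e : ℕ) :
    (diff ^ e) (veroneseHilb (m + e) (e + 1)) = powerHilb m (e + 1) := by
  induction e generalizing m with
  | zero =>
    ext k
    simp only [powerHilb, veroneseHilb, pow_zero, Module.End.one_apply, Nat.add_zero, zero_add]
    rw [monomialCount_congr fun a => ?_]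
    simp [Nat.one_le_iff_ne_zero, Finsupp.degree_eq_zero_iff]
  | succ e ih =>
    induction m with
    | zero =>
      -- With `e + 1` variables no support has `e + 2` elements.
      have : veroneseHilb (0 + (e + 1)) (e + 1 + 1) = 0 := by
        ext k
        simp only [veroneseHilb]
        rw [monomialCount_false fun a => ?_]
        · rfl
        · have := a.support.card_le_univ
          rw [Fintype.card_fin] at this
          omega
      rw [this, map_zero]
      ext k
      simp only [powerHilb]
      rw [monomialCount_false fun a => ?_]
      · rfl
      · simp [Subsingleton.elim a 0]
    | succ m ihm =>
      -- The two recursions match term by term: `ihm` handles the summand with one variable fewer,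
      -- `ih (m + 1)` the shifted one.
      rw [powerHilb_succ, ← ihm, ← ih (m + 1), ← diff_pow_shift, pow_succ, Module.End.mul_apply,
        Module.End.mul_apply, ← map_add, show m + 1 + (e + 1) = (m + (e + 1)) + 1 by ring,
        diff_veroneseHilb_succ, show m + (e + 1) = m + 1 + e by ring]

/-- Decompositions of the Hilbert function of `𝔪 ^ d` and of `I_{n,d}` into Hilbert functions of
shifted polynomial rings correspond to each other. -/
lemma powerHilb_eq_sum_iff (m e : ℕ) {N : ℕ} (r : Fin N → ℕ) (s : Fin N → ℤ) :
    (powerHilb m (e + 1) = ∑ i, fun k => polyHilb (r i) (k - s i)) ↔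
      veroneseHilb (m + e) (e + 1) = ∑ i, fun k => polyHilb (r i + e) (k - s i) := by
  have h : (diff ^ e) (∑ i, fun k => polyHilb (r i + e) (k - s i)) =
      ∑ i, fun k => polyHilb (r i) (k - s i) := by
    rw [map_sum]
    exact Finset.sum_congr rfl fun i _ => by rw [diff_pow_translate, diff_pow_polyHilb]
  constructor
  · intro H
    rw [← sub_eq_zero]
    obtain ⟨b, hb⟩ := (Set.finite_range s).bddBelow
    -- Below `0` there are no monomials, and below `b` every shifted summand vanishes.
    refine eq_zero_of_diff_pow_eq_zero e _ (min 0 b) (fun k hk => ?_) ?_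
    · rw [lt_min_iff] at hk
      rw [Pi.sub_apply, Finset.sum_apply, Finset.sum_eq_zero, sub_zero]
      · simp only [veroneseHilb]
        rw [monomialCount_of_neg _ hk.1]; rfl
      · intro i _
        have := hb ⟨i, rfl⟩
        simp only [polyHilb]
        rw [monomialCount_of_neg _ (by omega)]; rfl
    · rw [map_sub, diff_pow_veroneseHilb, h, H, sub_self]
  · intro H
    rw [← diff_pow_veroneseHilb, H, h]

end HilbertDepth

/-! ### Depth of polynomial rings. -/

namespace HilbertDepth
open RingTheory.Sequence

/-- A regular element avoids the minimal primes of the support, so each quotient lowers the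
dimension by at least one. -/
lemma length_le_supportDim_of_isRegular {A : Type*} [CommRing A] [IsNoetherianRing A]
    {M : Type*} [AddCommGroup M] [Module A M] [Module.Finite A M] {rs : List A}
    (h : IsRegular M rs) : (rs.length : WithBot ℕ∞) ≤ Module.supportDim A M := by
  induction rs generalizing M with
  | nil =>
    have := h.nontrivial
    have h0 := (Module.supportDim_ne_bot_iff_nontrivial A M).2 this
    rw [← WithBot.coe_unbot _ h0]
    exact WithBot.coe_le_coe.mpr zero_le
  | cons r rs ih =>
    rw [isRegular_cons_iff] at h
    refine le_trans ?_ (Module.supportDim_quotSMulTop_succ_le_of_notMem_minimalPrimes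
      fun _ => h.1.notMem_of_mem_minimalPrimes)
    rw [List.length_cons]
    push_cast
    exact add_le_add_left (ih h.2) 1

lemma depth_le_ringKrullDim {A : Type*} [CommRing A] [IsNoetherianRing A] [Nontrivial A]
    (J : Ideal A) : (depth J A : WithBot ℕ∞) ≤ ringKrullDim A := by
  have h0 : ringKrullDim A ≠ ⊥ :=
    (bot_lt_iff_ne_bot.1 ((WithBot.bot_lt_coe _).trans_le ringKrullDim_nonneg_of_nontrivial))
  rw [← WithBot.coe_unbot _ h0, WithBot.coe_le_coe]
  refine iSup₂_le fun rs hrs => ?_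
  rw [← WithBot.coe_le_coe, WithBot.coe_unbot]
  have := length_le_supportDim_of_isRegular hrs.2
  rw [Module.supportDim_self_eq_ringKrullDim] at this
  exact this

lemma depth_le_of_ringEquiv {A B : Type*} [CommRing A] [CommRing B] (e : A ≃+* B) {J : Ideal A}
    {J' : Ideal B} (h : ∀ a ∈ J, e a ∈ J') : depth J A ≤ depth J' B := by
  refine iSup₂_le fun rs hrs => ?_
  rw [← List.length_map (as := rs) (f := e)]
  refine le_iSup₂_of_le (rs.map e) ⟨?_, ?_⟩ le_rfl
  · simpa using fun a ha => h a (hrs.1 a ha)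
  · refine (AddEquiv.isRegular_congr (e := e.toAddEquiv) ?_).1 hrs.2
    refine List.forall₂_map_right_iff.mpr (List.forall₂_same.mpr fun r _ x => ?_)
    exact map_mul e r x

lemma depth_congr {A B : Type*} [CommRing A] [CommRing B] (e : A ≃+* B) {J : Ideal A}
    {J' : Ideal B} (h : ∀ a, a ∈ J ↔ e a ∈ J') : depth J A = depth J' B :=
  le_antisymm (depth_le_of_ringEquiv e fun a => (h a).1)
    (depth_le_of_ringEquiv e.symm fun b hb => (h _).2 (by simpa using hb))

lemma mem_irrelevantIdeal_iff {K : Type*} [Field K] {n : ℕ} (f : MvPolynomial (Fin n) K) :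
    f ∈ irrelevantIdeal K n ↔ MvPolynomial.constantCoeff f = 0 := by
  rw [irrelevantIdeal, ← Set.image_univ, MvPolynomial.mem_ideal_span_X_image,
    MvPolynomial.constantCoeff_eq]
  constructor
  · intro h
    by_contra h0
    obtain ⟨i, -, hi⟩ := h 0 (MvPolynomial.mem_support_iff.2 h0)
    exact hi rfl
  · intro h a ha
    by_contra! h0
    have : a = 0 := Finsupp.ext fun i => h0 i trivial
    exact MvPolynomial.mem_support_iff.1 ha (this ▸ h)

lemma isRegular_variables (K : Type*) [Field K] (n : ℕ) :
    IsRegular (MvPolynomial (Fin n) K)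
      (List.ofFn (MvPolynomial.X : Fin n → MvPolynomial (Fin n) K)) := by
  have hspan (s : Set (Fin n)) (l : List (MvPolynomial (Fin n) K))
      (hl : {x | x ∈ l} = MvPolynomial.X '' s) :
      (Ideal.ofList l • ⊤ : Submodule (MvPolynomial (Fin n) K) (MvPolynomial (Fin n) K)) =
        Ideal.span (MvPolynomial.X '' s) := by
    rw [Ideal.ofList, hl, smul_eq_mul, Ideal.mul_top]
  constructor
  · constructor
    intro i hi
    have hi' : i < n := by simpa using hi
    rw [hspan {j | j.1 < i} _ ?_, isSMulRegular_iff_right_eq_zero_of_smul]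
    · intro x
      obtain ⟨f, rfl⟩ := Submodule.Quotient.mk_surjective _ x
      rw [← Submodule.Quotient.mk_smul, Submodule.Quotient.mk_eq_zero,
        Submodule.Quotient.mk_eq_zero, MvPolynomial.mem_ideal_span_X_image,
        MvPolynomial.mem_ideal_span_X_image]
      intro h a ha
      obtain ⟨j, hj, hj'⟩ := h (Finsupp.single ⟨i, hi'⟩ 1 + a) (by
        rw [MvPolynomial.mem_support_iff] at ha ⊢
        simpa [MvPolynomial.coeff_X_mul] using ha)
      refine ⟨j, hj, ?_⟩
      -- Multiplying by the new variable leaves the exponents of the earlier ones unchanged.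
      have hne : j ≠ ⟨i, hi'⟩ := by
        rintro rfl
        exact lt_irrefl i hj
      simpa [Finsupp.single_apply, hne.symm] using hj'
    · ext f
      simp only [Set.mem_ofPred_eq, List.mem_take_iff_getElem, Set.mem_image]
      constructor
      · rintro ⟨j, hj, rfl⟩
        have hj' : j < i := by omega
        exact ⟨⟨j, by omega⟩, hj', by simp⟩
      · rintro ⟨j, hj, rfl⟩
        exact ⟨j.1, by simp at hj ⊢; omega, by simp⟩
  · rw [hspan Set.univ _ (by ext f; simp [List.mem_ofFn])]
    intro h
    have h1 : (1 : MvPolynomial (Fin n) K) ∈ irrelevantIdeal K n := by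
      rw [irrelevantIdeal, ← Set.image_univ, ← h]; trivial
    rw [mem_irrelevantIdeal_iff] at h1
    simp at h1

/-- Krull dimension bounds the depth above; the sequence of variables attains it. -/
lemma depth_irrelevantIdeal (K : Type*) [Field K] (n : ℕ) :
    depth (irrelevantIdeal K n) (MvPolynomial (Fin n) K) = n := by
  apply le_antisymm
  · have := depth_le_ringKrullDim (irrelevantIdeal K n)
    rw [MvPolynomial.ringKrullDim_of_isNoetherianRing, ringKrullDim_eq_zero_of_field, zero_add,
      Nat.card_fin] at this
    exact_mod_cast this
  · refine le_iSup₂_of_le (List.ofFn MvPolynomial.X) ⟨?_, isRegular_variables K n⟩ (by simp)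
    intro r hr
    obtain ⟨i, rfl⟩ := List.mem_ofFn.1 hr
    exact Ideal.subset_span ⟨i, rfl⟩

end HilbertDepth

/-! ### Structure of graded retracts. -/

namespace HilbertDepth
open MvPolynomial

variable {K : Type*} [Field K] {n : ℕ}

lemma weight_one_eq_degree (a : Fin n →₀ ℕ) :
    Finsupp.weight (fun _ : Fin n => (1 : ℤ)) a = (a.degree : ℤ) := by
  rw [Finsupp.degree_apply, Finsupp.weight_apply]
  simp [Finsupp.sum]

lemma mem_polyPart_iff {k : ℤ} {f : MvPolynomial (Fin n) K} :
    f ∈ polyPart K n k ↔ ∀ a, coeff a f ≠ 0 → (a.degree : ℤ) = k := by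
  simp only [polyPart, mem_weightedHomogeneousSubmodule, IsWeightedHomogeneous,
    weight_one_eq_degree]

lemma mem_polyPart_natCast_iff {k : ℕ} {f : MvPolynomial (Fin n) K} :
    f ∈ polyPart K n k ↔ f.IsHomogeneous k := by
  simp only [mem_polyPart_iff, IsHomogeneous, IsWeightedHomogeneous,
    Finsupp.degree_eq_weight_one, Nat.cast_inj]
  rfl

lemma eq_zero_of_mem_polyPart_neg {k : ℤ} (hk : k < 0) {f : MvPolynomial (Fin n) K}
    (hf : f ∈ polyPart K n k) : f = 0 := by
  ext a
  by_contra h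
  have := mem_polyPart_iff.1 hf a h
  omega

lemma X_mem_polyPart (i : Fin n) : (X i : MvPolynomial (Fin n) K) ∈ polyPart K n 1 := by
  rw [← Nat.cast_one, mem_polyPart_natCast_iff]
  exact isHomogeneous_X K i

lemma polyPart_one_eq_span : polyPart K n 1 = Submodule.span K (Set.range X) := by
  rw [← homogeneousSubmodule_one_eq_span_X]
  ext f
  rw [← Nat.cast_one, mem_polyPart_natCast_iff, mem_homogeneousSubmodule]

lemma aeval_mem_polyPart {r : ℕ} {g : Fin r → MvPolynomial (Fin n) K}
    (hg : ∀ i, g i ∈ polyPart K n 1) {k : ℤ} {f : MvPolynomial (Fin r) K}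
    (hf : f ∈ polyPart K r k) : aeval g f ∈ polyPart K n k := by
  rcases lt_or_ge k 0 with hk | hk
  · rw [eq_zero_of_mem_polyPart_neg hk hf, map_zero]
    exact zero_mem _
  · lift k to ℕ using hk
    rw [mem_polyPart_natCast_iff] at hf ⊢
    simpa using hf.aeval g (n := 1) fun i => mem_polyPart_natCast_iff.1 (by simpa using hg i)

/-- A graded isomorphism of `S` with the standard graded polynomial ring in `r` variables. -/
def IsGradedPolyEquiv {r : ℕ} (S : Subalgebra K (MvPolynomial (Fin n) K))
    (φ : MvPolynomial (Fin r) K ≃ₐ[K] S) : Prop :=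
  ∀ (k : ℤ) (f : MvPolynomial (Fin r) K),
    f ∈ polyPart K r k ↔ (φ f : MvPolynomial (Fin n) K) ∈ polyPart K n k

/-- A graded retract of the polynomial ring is a polynomial ring generated by linear forms. -/
lemma IsGradedRetract.exists_isGradedPolyEquiv {S : Subalgebra K (MvPolynomial (Fin n) K)}
    (hS : IsGradedRetract S) :
    ∃ r ≤ n, ∃ φ : MvPolynomial (Fin r) K ≃ₐ[K] S, IsGradedPolyEquiv S φ := by
  obtain ⟨ρ, hρ, hdeg⟩ := hS
  let ρ' : MvPolynomial (Fin n) K →ₗ[K] MvPolynomial (Fin n) K := (S.val.comp ρ).toLinearMap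
  -- `V` is the degree one part of `S`, since `ρ` is the identity there; a basis of it will serve as
  -- the polynomial generators.
  let V : Submodule K (MvPolynomial (Fin n) K) := Submodule.span K (Set.range fun i => ρ' (X i))
  have hV : V ≤ polyPart K n 1 := by
    rw [Submodule.span_le]
    rintro _ ⟨i, rfl⟩
    exact hdeg 1 _ (X_mem_polyPart i)
  have hVS : ∀ v : V, (v : MvPolynomial (Fin n) K) ∈ S := by
    have : V ≤ Subalgebra.toSubmodule S := by
      rw [Submodule.span_le]
      rintro _ ⟨i, rfl⟩
      exact (ρ (X i)).2
    exact fun v => this v.2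
  have hρV : ∀ f ∈ polyPart K n 1, ρ' f ∈ V := by
    intro f hf
    rw [polyPart_one_eq_span] at hf
    have := Submodule.mem_map_of_mem (f := ρ') hf
    rw [Submodule.map_span, ← Set.range_comp] at this
    exact this
  have : Module.Finite K V := Module.Finite.span_of_finite K (Set.finite_range _)
  let b := Module.finBasis K V
  have hr : Module.finrank K V ≤ n := by
    exact (finrank_range_le_card fun i => ρ' (X i)).trans_eq (Fintype.card_fin n)
  refine ⟨_, hr, ?_⟩
  let φ₀ : MvPolynomial (Fin (Module.finrank K V)) K →ₐ[K] S := aeval fun j => ⟨b j, hVS (b j)⟩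
  -- The left inverse of `φ₀`: project each variable by `ρ` and read off coordinates in `b`.
  let ψ : MvPolynomial (Fin n) K →ₐ[K] MvPolynomial (Fin (Module.finrank K V)) K :=
    aeval fun i => ∑ j, b.repr ⟨ρ' (X i), hρV _ (X_mem_polyPart i)⟩ j • X j
  have hψ1 : ∀ v : V, ψ v = ∑ j, b.repr v j • X j := by
    let L : V →ₗ[K] MvPolynomial (Fin (Module.finrank K V)) K :=
      (Fintype.linearCombination K X).comp (b.equivFun : V →ₗ[K] _)
    let P : polyPart K n 1 →ₗ[K] V := (ρ'.comp (polyPart K n 1).subtype).codRestrict V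
      fun f => hρV f f.2
    have key : ∀ f (hf : f ∈ polyPart K n 1), ψ f = L (P ⟨f, hf⟩) := by
      intro f hf
      have hf' := hf
      rw [polyPart_one_eq_span] at hf'
      induction hf' using Submodule.span_induction with
      | mem f h =>
        obtain ⟨i, rfl⟩ := h
        simp [ψ, L, P, Fintype.linearCombination_apply]
        rfl
      | zero => rw [map_zero, show (⟨0, hf⟩ : polyPart K n 1) = 0 from rfl, map_zero, map_zero]
      | add f g hf1 hg1 ihf ihg =>
        rw [← polyPart_one_eq_span] at hf1 hg1
        rw [map_add, ihf hf1, ihg hg1, ← map_add, ← map_add]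
        rfl
      | smul c f hf1 ih =>
        rw [← polyPart_one_eq_span] at hf1
        rw [map_smul, ih hf1, ← map_smul, ← map_smul]
        rfl
    intro v
    rw [key _ (hV v.2)]
    have : P ⟨_, hV v.2⟩ = v := Subtype.ext (congrArg (Subtype.val (p := (· ∈ S))) (hρ ⟨v, hVS v⟩))
    rw [this]
    simp [L, Fintype.linearCombination_apply]
  have hψφ : ∀ f, ψ (φ₀ f : S) = f := by
    intro f
    have : (ψ.comp S.val).comp φ₀ = AlgHom.id K _ := by
      ext1 j
      simp [φ₀, hψ1, Finsupp.single_apply]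
    exact AlgHom.congr_fun this f
  have hsurj : Function.Surjective φ₀ := by
    have hVr : ∀ v : V, ⟨v, hVS v⟩ ∈ φ₀.range := by
      intro v
      have : (⟨v, hVS v⟩ : S) = ∑ j, b.repr v j • (⟨b j, hVS (b j)⟩ : S) := by
        ext1
        have := congrArg V.subtype (b.sum_repr v)
        rw [map_sum] at this
        simpa only [map_smul, AddSubmonoidClass.coe_finsetSum, Subalgebra.coe_smul,
          Submodule.subtype_apply] using this.symm
      rw [this]
      refine sum_mem fun j _ => Subalgebra.smul_mem _ ?_ _
      exact ⟨X j, by simp [φ₀]⟩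
    -- `S` is the image of `ρ`, hence generated by the `ρ (X i)`, which lie in `V`.
    have : ρ.range ≤ φ₀.range := by
      rw [← Algebra.map_top, ← adjoin_range_X, AlgHom.map_adjoin, Algebra.adjoin_le_iff]
      rintro _ ⟨_, ⟨i, rfl⟩, rfl⟩
      exact hVr ⟨_, Submodule.subset_span ⟨i, rfl⟩⟩
    exact fun x => this ⟨x, hρ x⟩
  have hφ : ∀ k f, f ∈ polyPart K _ k → (φ₀ f : MvPolynomial (Fin n) K) ∈ polyPart K n k := by
    intro k f hf
    have : S.val.comp φ₀ = aeval fun j => (b j : MvPolynomial (Fin n) K) := by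
      ext1 j
      simp [φ₀]
    have h := AlgHom.congr_fun this f
    rw [AlgHom.comp_apply, Subalgebra.coe_val] at h
    rw [h]
    exact aeval_mem_polyPart (fun j => hV (b j).2) hf
  refine ⟨AlgEquiv.ofBijective φ₀ ⟨fun f g h => ?_, hsurj⟩, fun k f => ⟨hφ k f, fun h => ?_⟩⟩
  · rw [← hψφ f, h, hψφ]
  · rw [← hψφ f]
    refine aeval_mem_polyPart (fun i => sum_mem fun j _ => ?_) h
    exact Submodule.smul_mem _ _ (X_mem_polyPart j)

/-- The subring on the first `r` variables is split off by sending the others to zero. -/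
lemma exists_isGradedRetract (K : Type*) [Field K] {r n : ℕ} (hr : r ≤ n) :
    ∃ S : Subalgebra K (MvPolynomial (Fin n) K), IsGradedRetract S ∧
      ∃ φ : MvPolynomial (Fin r) K ≃ₐ[K] S, IsGradedPolyEquiv S φ := by
  have hinj := Fin.castLE_injective hr
  let ι : MvPolynomial (Fin r) K →ₐ[K] MvPolynomial (Fin n) K := rename (Fin.castLE hr)
  let π : MvPolynomial (Fin n) K →ₐ[K] MvPolynomial (Fin r) K := killCompl hinj
  let φ : MvPolynomial (Fin r) K ≃ₐ[K] ι.range := AlgEquiv.ofInjective ι (rename_injective _ hinj)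
  have hπι : ∀ f, π (ι f) = f := killCompl_rename_app hinj
  have hι : ∀ k f, f ∈ polyPart K r k → ι f ∈ polyPart K n k := fun k f hf => by
    have : ι = aeval fun j => X (Fin.castLE hr j) := by ext1 j; simp [ι]
    rw [this]
    exact aeval_mem_polyPart (fun j => X_mem_polyPart _) hf
  have hπ : ∀ k f, f ∈ polyPart K n k → π f ∈ polyPart K r k := fun k f hf => by
    refine aeval_mem_polyPart (fun j => ?_) hf
    split_ifs
    · exact X_mem_polyPart _
    · exact zero_mem _
  refine ⟨ι.range, ⟨(φ : MvPolynomial (Fin r) K →ₐ[K] ι.range).comp π, ?_, fun k f hf => hι _ _ (hπ _ _ hf)⟩, φ,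
    fun k f => ⟨hι k f, fun h => ?_⟩⟩
  · rintro ⟨_, f, rfl⟩
    exact Subtype.ext (congrArg ι (hπι f))
  · rw [← hπι f]
    exact hπ _ _ h

lemma IsGradedPolyEquiv.retractDepth_eq {r : ℕ} {S : Subalgebra K (MvPolynomial (Fin n) K)}
    {φ : MvPolynomial (Fin r) K ≃ₐ[K] S} (hφ : IsGradedPolyEquiv S φ) : retractDepth S = r := by
  rw [← depth_irrelevantIdeal K r, retractDepth]
  refine (depth_congr φ.toRingEquiv fun f => ?_).symm
  rw [mem_irrelevantIdeal_iff, Ideal.mem_comap, mem_irrelevantIdeal_iff]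
  -- The isomorphism preserves constant terms, as it sends variables to linear forms; so irrelevant
  -- ideals correspond.
  have : (constantCoeff.comp S.val.toRingHom).comp (φ : MvPolynomial (Fin r) K →+* S) =
      constantCoeff := by
    refine ringHom_ext (fun c => ?_) fun i => ?_
    · have : φ (C c) = algebraMap K S c := φ.commutes c
      simp only [RingHom.comp_apply, RingHom.coe_coe, this, constantCoeff_C]
      exact constantCoeff_C _ c
    · have := (hφ 1 _).1 (X_mem_polyPart i)
      rw [mem_polyPart_iff] at this
      simp only [constantCoeff_X, RingHom.comp_apply, constantCoeff_eq]
      by_contra h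
      simpa using this 0 h
  exact (congrArg (· = 0) (RingHom.congr_fun this f).symm).to_iff

end HilbertDepth

/-! ### Homogeneous bases and the numerical criterion. -/

namespace HilbertDepth
open MvPolynomial
open scoped DirectSum

/-- A basis of a graded vector space that consists of homogeneous elements. -/
structure HomogeneousBasis {K : Type*} [Field K] {M : Type*} [AddCommMonoid M] [Module K M]
    (ι : Type*) (𝓜 : ℤ → Submodule K M) where
  basis : Module.Basis ι K M
  deg : ι → ℤ
  mem_iff : ∀ k x, x ∈ 𝓜 k ↔ ∀ i, basis.repr x i ≠ 0 → deg i = k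

section

variable {K : Type*} [Field K] {M N : Type*} [AddCommMonoid M] [Module K M] [AddCommMonoid N]
  [Module K N] {ι κ : Type*} {𝓜 : ℤ → Submodule K M} {𝓝 : ℤ → Submodule K N}

lemma HomogeneousBasis.finrank_eq (B : HomogeneousBasis ι 𝓜) (k : ℤ) :
    Module.finrank K (𝓜 k) = Nat.card {i // B.deg i = k} := by
  have h : (𝓜 k).map (B.basis.repr : M →ₗ[K] ι →₀ K) = Finsupp.supported K K {i | B.deg i = k} := by
    ext y
    rw [Submodule.mem_map_equiv, B.mem_iff, Finsupp.mem_supported]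
    simp only [LinearEquiv.apply_symm_apply]
    exact ⟨fun h i hi => h i (Finsupp.mem_support_iff.1 hi),
      fun h i hi => h (Finsupp.mem_support_iff.2 hi)⟩
  rw [((B.basis.repr.submoduleMap (𝓜 k)).trans (LinearEquiv.ofEq _ _ h)).finrank_eq,
    (Finsupp.supportedEquivFinsupp _).finrank_eq,
    Module.finrank_eq_nat_card_basis (Finsupp.basisSingleOne (R := K))]
  rfl

lemma HomogeneousBasis.exists_gradedIso_iff (B : HomogeneousBasis ι 𝓜)
    (B' : HomogeneousBasis κ 𝓝) (hB : ∀ k, Finite {i // B.deg i = k})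
    (hB' : ∀ k, Finite {i // B'.deg i = k}) :
    (∃ e : M ≃ₗ[K] N, ∀ k x, x ∈ 𝓜 k ↔ e x ∈ 𝓝 k) ↔
      ∀ k, Nat.card {i // B.deg i = k} = Nat.card {i // B'.deg i = k} := by
  constructor
  · rintro ⟨e, he⟩ k
    rw [← B.finrank_eq, ← B'.finrank_eq]
    refine ((e.submoduleMap (𝓜 k)).trans (LinearEquiv.ofEq _ _ ?_)).finrank_eq
    ext y
    rw [Submodule.mem_map_equiv, he, e.apply_symm_apply]
  · intro h
    -- Equal finite fibres are matched degree by degree, then glued to a degree-preserving bijection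
    -- `τ` of the bases. Finiteness matters because `Nat.card` is zero on infinite types.
    let σ (k : ℤ) : {i // B.deg i = k} ≃ {i // B'.deg i = k} := by
      have := hB k
      have := hB' k
      exact (Finite.equivFinOfCardEq (h k)).trans (Finite.equivFin _).symm
    let τ : ι ≃ κ := ((Equiv.sigmaFiberEquiv B.deg).symm.trans (Equiv.sigmaCongrRight σ)).trans
      (Equiv.sigmaFiberEquiv B'.deg)
    have hτ : ∀ i, B'.deg (τ i) = B.deg i := fun i => (σ (B.deg i) ⟨i, rfl⟩).2
    refine ⟨B.basis.equiv B'.basis τ, fun k x => ?_⟩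
    rw [B.mem_iff, B'.mem_iff]
    have hr : ∀ i, B'.basis.repr (B.basis.equiv B'.basis τ x) (τ i) = B.basis.repr x i := by
      intro i
      have := (B'.basis.repr_reindex_apply (B.basis.equiv B'.basis τ x) τ.symm i).symm
      rw [τ.symm_symm] at this
      rw [this, Module.Basis.equiv, LinearEquiv.trans_apply, LinearEquiv.apply_symm_apply]
    rw [τ.surjective.forall]
    simp only [hr, hτ]

end

variable {K : Type*} [Field K] {n : ℕ}

/-- The monomials in the generators of a graded retract form a homogeneous basis. -/
noncomputable def IsGradedPolyEquiv.homogeneousBasis {r : ℕ}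
    {S : Subalgebra K (MvPolynomial (Fin n) K)} {φ : MvPolynomial (Fin r) K ≃ₐ[K] S}
    (hφ : IsGradedPolyEquiv S φ) (s : ℤ) : HomogeneousBasis (Fin r →₀ ℕ) (shiftPart S s) where
  basis := (basisMonomials (Fin r) K).map φ.toLinearEquiv
  deg a := a.degree + s
  mem_iff k x := by
    have h : x ∈ shiftPart S s k ↔ φ.symm x ∈ polyPart K r (k - s) := by
      rw [hφ, φ.apply_symm_apply]
      rfl
    rw [h, mem_polyPart_iff]
    exact forall_congr' fun a => imp_congr Iff.rfl eq_sub_iff_add_eq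

/-- The degree `k` component of a direct sum of shifted retracts. -/
noncomputable def sumPart {N : ℕ} (S : Fin N → Subalgebra K (MvPolynomial (Fin n) K))
    (s : Fin N → ℤ) (k : ℤ) : Submodule K (⨁ i, S i) where
  carrier := {x | ∀ i, x i ∈ shiftPart (S i) (s i) k}
  add_mem' hx hy i := add_mem (hx i) (hy i)
  zero_mem' _ := zero_mem _
  smul_mem' c _ hx i := Submodule.smul_mem _ c (hx i)

/-- The monomials of the summands form a homogeneous basis of a direct sum of shifted retracts. -/
noncomputable def sumHomogeneousBasis {N : ℕ} {S : Fin N → Subalgebra K (MvPolynomial (Fin n) K)}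
    {r : Fin N → ℕ} {φ : ∀ i, MvPolynomial (Fin (r i)) K ≃ₐ[K] S i}
    (hφ : ∀ i, IsGradedPolyEquiv (S i) (φ i)) (s : Fin N → ℤ) :
    HomogeneousBasis (Σ i, Fin (r i) →₀ ℕ) (sumPart S s) where
  basis := DFinsupp.basis fun i => ((hφ i).homogeneousBasis (s i)).basis
  deg a := a.2.degree + s a.1
  mem_iff k x := by
    have h : x ∈ sumPart S s k ↔ ∀ i, x i ∈ shiftPart (S i) (s i) k := Iff.rfl
    rw [h, Sigma.forall]
    exact forall_congr' fun i => ((hφ i).homogeneousBasis (s i)).mem_iff k (x i)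

/-- The fibre of the degree map of `sumHomogeneousBasis`. -/
def sumFiberEquiv {N : ℕ} (r : Fin N → ℕ) (s : Fin N → ℤ) (k : ℤ) :
    {a : Σ i, Fin (r i) →₀ ℕ // (a.2.degree + s a.1 : ℤ) = k} ≃
      Σ i, {a : Fin (r i) →₀ ℕ // True ∧ (a.degree : ℤ) = k - s i} where
  toFun a := ⟨a.1.1, a.1.2, trivial, eq_sub_iff_add_eq.2 a.2⟩
  invFun a := ⟨⟨a.1, a.2.1⟩, eq_sub_iff_add_eq.1 a.2.2.2⟩

/-- The monomials of a monomial ideal form a homogeneous basis. -/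
noncomputable def idealHomogeneousBasis (I : Ideal (MvPolynomial (Fin n) K))
    (P : (Fin n →₀ ℕ) → Prop) (hI : ∀ f, f ∈ I ↔ ∀ a, coeff a f ≠ 0 → P a) :
    HomogeneousBasis {a // P a} (idealPart I) where
  basis := (basisRestrictSupport K {a | P a}).map
    { toFun f := ⟨f.1, (hI f.1).2 fun _ ha => f.2 (mem_support_iff.2 ha)⟩
      invFun f := ⟨f.1, fun a ha => (hI f.1).1 f.2 a (mem_support_iff.1 ha)⟩
      map_add' _ _ := rfl
      map_smul' _ _ := rfl }
  deg a := a.1.degree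
  mem_iff k x := by
    have h : x ∈ idealPart I k ↔ (x : MvPolynomial (Fin n) K) ∈ polyPart K n k := Iff.rfl
    rw [h, mem_polyPart_iff, Subtype.forall]
    exact ⟨fun H a _ ha => H a ha, fun H a ha => H a ((hI x).1 x.2 a ha) ha⟩

/-- The Hilbert decompositions of a monomial ideal are governed by its Hilbert function. -/
lemma exists_le_hdepth_iff (I : Ideal (MvPolynomial (Fin n) K)) (P : (Fin n →₀ ℕ) → Prop)
    (hI : ∀ f, f ∈ I ↔ ∀ a, coeff a f ≠ 0 → P a) (p : ℕ) :
    (∃ H : HilbertDecomposition n (idealPart I), (p : ℕ∞) ≤ H.hdepth) ↔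
      ∃ (N : ℕ) (r : Fin N → ℕ) (s : Fin N → ℤ), (∀ i, p ≤ r i ∧ r i ≤ n) ∧
        (fun k => (monomialCount n P k : ℤ)) = ∑ i, fun k => polyHilb (r i) (k - s i) := by
  -- For fixed retracts, a graded isomorphism exists exactly when the Hilbert functions agree.
  have key {N : ℕ} {S : Fin N → Subalgebra K (MvPolynomial (Fin n) K)} {r : Fin N → ℕ}
      {φ : ∀ i, MvPolynomial (Fin (r i)) K ≃ₐ[K] S i} (hφ : ∀ i, IsGradedPolyEquiv (S i) (φ i))
      (s : Fin N → ℤ) : (∃ e : I ≃ₗ[K] (⨁ i, S i), ∀ (k : ℤ) (x : I), x ∈ idealPart I k ↔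
        ∀ i, e x i ∈ shiftPart (S i) (s i) k) ↔
      (fun k => (monomialCount n P k : ℤ)) = ∑ i, fun k => polyHilb (r i) (k - s i) := by
    have hfin (k : ℤ) (i : Fin N) := finite_degree_eq (r i) (fun _ => True) (k - s i)
    have hcount (k : ℤ) : Nat.card {a : {a // P a} // (a.1.degree : ℤ) = k} =
        monomialCount n P k :=
      Nat.card_congr (Equiv.subtypeSubtypeEquivSubtypeInter P fun a => (a.degree : ℤ) = k)
    have hsum (k : ℤ) : (Nat.card {a : Σ i, Fin (r i) →₀ ℕ // (a.2.degree + s a.1 : ℤ) = k} : ℤ)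
        = ∑ i, polyHilb (r i) (k - s i) := by
      rw [Nat.card_congr (sumFiberEquiv r s k), Nat.card_sigma]
      push_cast
      rfl
    refine ((idealHomogeneousBasis I P hI).exists_gradedIso_iff (sumHomogeneousBasis hφ s)
      (fun k => ?_) (fun k => ?_)).trans ?_
    · have := finite_degree_eq n P k
      exact Finite.of_equiv _
        (Equiv.subtypeSubtypeEquivSubtypeInter P fun a => (a.degree : ℤ) = k).symm
    · exact Finite.of_equiv _ (sumFiberEquiv r s k).symm
    · rw [funext_iff]
      refine forall_congr' fun k => ?_
      rw [Finset.sum_apply, ← hsum, ← hcount]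
      exact Nat.cast_inj.symm
  constructor
  · rintro ⟨H, hH⟩
    choose r hr φ hφ using fun i => (H.isGradedRetract i).exists_isGradedPolyEquiv
    refine ⟨H.size, r, H.s, fun i => ⟨?_, hr i⟩, (key hφ H.s).1 H.exists_gradedIso⟩
    have := hH.trans (iInf_le _ i)
    rw [(hφ i).retractDepth_eq] at this
    exact_mod_cast this
  · rintro ⟨N, r, s, hr, h⟩
    choose S hS φ hφ using fun i => exists_isGradedRetract K (hr i).2
    refine ⟨⟨N, S, s, hS, (key hφ s).2 h⟩, le_iInf fun i => ?_⟩
    rw [(hφ i).retractDepth_eq]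
    exact_mod_cast (hr i).1

/-! ### Comparing the two ideals. -/

/-- For `p = q + 1` the bound means `q < ⨆`, which some decomposition witnesses. At `p = 0` the left
side would hold even without any decomposition. -/
lemma le_Hdepth_iff (I : Ideal (MvPolynomial (Fin n) K)) {p : ℕ} (hp : 1 ≤ p) :
    (p : ℕ∞) ≤ Hdepth I ↔ ∃ H : HilbertDecomposition n (idealPart I), (p : ℕ∞) ≤ H.hdepth := by
  obtain ⟨q, rfl⟩ := Nat.exists_eq_add_of_le' hp
  have h (x : ℕ∞) : ((q + 1 : ℕ) : ℕ∞) ≤ x ↔ (q : ℕ∞) < x := by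
    push_cast
    exact ENat.add_one_le_iff (ENat.natCast_ne_top q)
  simp only [h]
  exact lt_iSup_iff

lemma eq_natCast_iff (x : ℕ∞) (c : ℕ) :
    x = c ↔ (c : ℕ∞) ≤ x ∧ ¬ ((c + 1 : ℕ) : ℕ∞) ≤ x := by
  push_cast
  rw [ENat.add_one_le_iff (ENat.natCast_ne_top c), not_lt, le_antisymm_iff, and_comm]

lemma mem_irrelevantIdeal_pow_iff (d : ℕ) (f : MvPolynomial (Fin n) K) :
    f ∈ irrelevantIdeal K n ^ d ↔ ∀ a, coeff a f ≠ 0 → d ≤ a.degree := by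
  rw [irrelevantIdeal, mem_pow_idealOfVars_iff]
  simp only [mem_support_iff]

/-- A monomial is divisible by a squarefree one of degree `d` exactly when its support contains a
set of size `d`. -/
lemma mem_squarefreeVeronese_iff (d : ℕ) (f : MvPolynomial (Fin n) K) :
    f ∈ squarefreeVeronese K n d ↔ ∀ a, coeff a f ≠ 0 → d ≤ a.support.card := by
  have hgen : {f : MvPolynomial (Fin n) K | ∃ A : Finset (Fin n), A.card = d ∧ f = ∏ i ∈ A, X i} =
      (fun a => monomial a 1) ''
        {a | ∃ A : Finset (Fin n), A.card = d ∧ a = ∑ i ∈ A, Finsupp.single i 1} := by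
    ext f
    constructor
    · rintro ⟨A, hA, rfl⟩
      exact ⟨_, ⟨A, hA, rfl⟩, monomial_sum_one A _⟩
    · rintro ⟨_, ⟨A, hA, rfl⟩, rfl⟩
      exact ⟨A, hA, monomial_sum_one A _⟩
  rw [squarefreeVeronese, hgen, mem_ideal_span_monomial_image]
  simp only [mem_support_iff]
  refine forall_congr' fun a => imp_congr_right fun _ => ?_
  have happ (A : Finset (Fin n)) (j : Fin n) :
      (∑ i ∈ A, Finsupp.single i 1 : Fin n →₀ ℕ) j = if j ∈ A then 1 else 0 := by
    simp [Finsupp.finsetSum_apply, Finsupp.single_apply]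
  constructor
  · rintro ⟨_, ⟨A, rfl, rfl⟩, hle⟩
    refine Finset.card_le_card fun j hj => ?_
    have := hle j
    rw [happ, if_pos hj] at this
    rw [Finsupp.mem_support_iff]
    omega
  · intro hd
    obtain ⟨A, hA, rfl⟩ := Finset.exists_subset_card_eq hd
    refine ⟨_, ⟨A, rfl, rfl⟩, fun j => ?_⟩
    rw [happ]
    split_ifs with hj
    · exact Nat.one_le_iff_ne_zero.2 (Finsupp.mem_support_iff.1 (hA hj))
    · exact Nat.zero_le _

/-- The Hilbert depth of `I_{n,d}` exceeds that of `𝔪 ^ d` in `n - d + 1` variables by `d - 1`. -/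
lemma le_Hdepth_power_iff_le_Hdepth_veronese (m e : ℕ) {p : ℕ} (hp : 1 ≤ p) :
    (p : ℕ∞) ≤ Hdepth (irrelevantIdeal K m ^ (e + 1)) ↔
      ((e + p : ℕ) : ℕ∞) ≤ Hdepth (squarefreeVeronese K (m + e) (e + 1)) := by
  rw [le_Hdepth_iff _ hp, le_Hdepth_iff _ (by omega),
    exists_le_hdepth_iff _ _ (mem_irrelevantIdeal_pow_iff _),
    exists_le_hdepth_iff _ _ (mem_squarefreeVeronese_iff _)]
  refine exists_congr fun N => ⟨?_, ?_⟩
  · rintro ⟨r, s, hr, h⟩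
    refine ⟨fun i => r i + e, s, fun i => ?_, (powerHilb_eq_sum_iff m e r s).1 h⟩
    have := hr i
    dsimp only
    omega
  · rintro ⟨r, s, hr, h⟩
    refine ⟨fun i => r i - e, s, fun i => ?_, (powerHilb_eq_sum_iff m e _ s).2 ?_⟩
    · have := hr i
      dsimp only
      omega
    -- The truncated subtraction is exact because `e + p ≤ r i`.
    have hre : ∀ i, r i - e + e = r i := fun i => by have := hr i; omega
    simp only [hre]
    exact h

lemma powerFormula_iff_veroneseFormula (K : Type*) [Field K] {n d : ℕ} (hd : 1 ≤ d) (hdn : d ≤ n) :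
    PowerFormula K (n - d + 1) d ↔ VeroneseFormula K n d := by
  obtain ⟨e, rfl⟩ := Nat.exists_eq_add_of_le' hd
  obtain ⟨m, rfl⟩ := Nat.exists_eq_add_of_le' hdn
  have hn : m + (e + 1) - (e + 1) + 1 = m + 1 := by omega
  have hq : ((m + (e + 1) : ℕ) : ℚ) - (((e + 1 : ℕ) : ℚ) - 1) = ((m + 1 : ℕ) : ℚ) := by
    push_cast
    ring
  rw [PowerFormula, VeroneseFormula, hn, hq]
  set c := ⌈((m + 1 : ℕ) : ℚ) / (((e + 1 : ℕ) : ℚ) + 1)⌉₊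
  -- Positivity of `c` permits the threshold comparison at both `c` and `c + 1`, which together
  -- decide each formula.
  have hc : 1 ≤ c := Nat.ceil_pos.2 (by positivity)
  rw [show m + (e + 1) = m + 1 + e by ring, show e + 1 - 1 = e from rfl]
  change _ = (c : ℕ∞) ↔ _
  rw [eq_natCast_iff, eq_natCast_iff, le_Hdepth_power_iff_le_Hdepth_veronese _ _ hc,
    le_Hdepth_power_iff_le_Hdepth_veronese _ _ (Nat.le_add_left 1 c), ← add_assoc e c 1]

end HilbertDepth

theorem theorem1p3 (K : Type*) [Field K] :
    ((∀ n s : ℕ, 1 ≤ n → 1 ≤ s → HilbertDepth.PowerFormula K n s) ↔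
      (∀ n d : ℕ, 1 ≤ d → d ≤ n → HilbertDepth.VeroneseFormula K n d)) ∧
    (∀ n d : ℕ, 1 ≤ d → d ≤ n →
      (HilbertDepth.PowerFormula K (n - d + 1) d ↔ HilbertDepth.VeroneseFormula K n d)) := by
  refine ⟨⟨fun h n d hd hdn => ?_, fun h n s hn hs => ?_⟩,
    fun n d hd hdn => HilbertDepth.powerFormula_iff_veroneseFormula K hd hdn⟩
  · exact (HilbertDepth.powerFormula_iff_veroneseFormula K hd hdn).1 (h _ _ (by omega) hd)
  -- Every pair `(n, s)` arises from the Veronese parameters `(n + s - 1, s)`.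
  · have := (HilbertDepth.powerFormula_iff_veroneseFormula K (n := n + s - 1) hs (by omega)).2
      (h _ _ hs (by omega))
    rwa [show n + s - 1 - s + 1 = n by omega] at this
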